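/- Let $\mathbb{E}$ be a regular category, that is, a finitely complete category in which every kernel pair has a coequalizer and regular epimorphisms are stable under pullback. Then the following two conditions are equivalent. (1) $\mathbb{E}$ is a Mal'tsev category, i.e. every internal reflexive relation in $\mathbb{E}$ is an internal equivalence relation. (2) For all split epimorphisms with given sections $f'\colon X'\to Y'$, $s'\colon Y'\to X'$, $f's'=1_{Y'}$, and $f\colon X\to Y$, $s\colon Y\to X$, $fs=1_Y$, and all regular epimorphisms $x\colon X'\to X$ and $y\colon Y'\to Y$ with $fx=yf'$ and $xs'=sy$, the commutative square $fx=yf'$ is a regular pushout, i.e. the comparison map $(x,f')\colon X'\to X\times_Y Y'$ to the pullback of $f$ along $y$ is a regular epimorphism. -/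

import Mathlib

open CategoryTheory CategoryTheory.Limits

universe v u

/-- A category is a Mal'tsev category if it is finitely complete and every (internal) reflexive
relation in it is an (internal) equivalence relation. -/
class IsMaltsevCategory (E : Type u) [Category.{v} E] : Prop extends HasFiniteLimits E where
  isEquivalenceRelation_of_reflexive :
    ∀ {R X : E} (d₀ d₁ : R ⟶ X), ReflexiveRelation d₀ d₁ → IsEquivalenceRelation d₀ d₁

/-- An object of the category `Pt E`: a split epimorphism `f : X ⟶ Y` equipped with a
given section `s`. -/
structure Pt (E : Type u) [Category.{v} E] where
  /-- the domain of the split epimorphism -/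
  X : E
  /-- the codomain of the split epimorphism -/
  Y : E
  /-- the split epimorphism -/
  f : X ⟶ Y
  /-- the given section -/
  s : Y ⟶ X
  section_comp : s ≫ f = 𝟙 Y

namespace Pt

variable {E : Type u} [Category.{v} E]

/-- A morphism of split epimorphisms: a pair of morphisms commuting both with the split
epimorphisms and with the given sections. -/
@[ext]
structure Hom (A B : Pt E) where
  /-- the upper horizontal arrow -/
  x : A.X ⟶ B.X
  /-- the lower horizontal arrow -/
  y : A.Y ⟶ B.Y
  comm_f : x ≫ B.f = A.f ≫ y
  comm_s : A.s ≫ x = y ≫ B.s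

/-- The category of split epimorphisms with a given section. -/
instance : Category (Pt E) where
  Hom := Hom
  id A := { x := 𝟙 A.X, y := 𝟙 A.Y, comm_f := by simp, comm_s := by simp }
  comp φ ψ :=
    { x := φ.x ≫ ψ.x
      y := φ.y ≫ ψ.y
      comm_f := by rw [Category.assoc, ψ.comm_f, ← Category.assoc, φ.comm_f, Category.assoc]
      comm_s := by rw [← Category.assoc, φ.comm_s, Category.assoc, ψ.comm_s, Category.assoc] }
  id_comp φ := Hom.ext (Category.id_comp φ.x) (Category.id_comp φ.y)
  comp_id φ := Hom.ext (Category.comp_id φ.x) (Category.comp_id φ.y)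
  assoc φ ψ χ := Hom.ext (Category.assoc φ.x ψ.x χ.x) (Category.assoc φ.y ψ.y χ.y)

/-- For a morphism `(x, y) : (f', s') ⟶ (f, s)` of split epimorphisms, the comparison map from
the domain `X'` of `f'` to the pullback of `f` along `y`, with components `x` and `f'`. -/
noncomputable def comparison [HasPullbacks E] {A B : Pt E} (φ : A ⟶ B) :
    A.X ⟶ pullback B.f φ.y :=
  pullback.lift φ.x A.f φ.comm_f

/-- The square underlying a morphism of split epimorphisms is a regular pushout if the
comparison map to the pullback is a regular epimorphism. -/
def IsRegularPushout [HasPullbacks E] {A B : Pt E} (φ : A ⟶ B) : Prop :=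
  IsRegularEpi (comparison φ)

end Pt

/-!
Condition (1) amounts to difunctionality of every relation. For `D` between `A` and `B`, the
relation `a(d) D b(d')` on `D` is reflexive, and its symmetry is the difunctionality of `D`.

If relations are difunctional and a subobject `S` of `X ×_Y Y'` contains all pairs `(x z, f' z)`,
then, applying difunctionality to `S` as a relation between `X` and `Y'`, the pairs `(x a, f' a)`,
`(x s' f' a, f' a)` and `(x s' y', y')` show that `S` contains every pair `(x a, y')`. As `x` is a
regular epimorphism, so is its pullback, and these pairs exhaust `X ×_Y Y'`.

Conversely, let `S` be a subobject of `X ×_Y Z`, for two split epimorphisms over `Y`, containing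
the images of `X` and `Z` under the two sections. Then `S ⟶ Z` is a split epimorphism above
`X ⟶ Y` and the comparison map is the inclusion of `S`, so (2) forces `S` to be everything. Apply
this to the object of triples `a D b`, `a' D b`, `a' D b'`, with `S` given by `a D b'`: the two
sections give the degenerate triples, those with `b' = b` and those with `a' = a`.
-/

section JointlyMono

variable {E : Type u} [Category.{v} E] {A B P : E}

lemma jointlyMono₂_comp {Q : E} (m : Q ⟶ P) [Mono m] (f : P ⟶ A) (g : P ⟶ B)
    [JointlyMono₂ f g] : JointlyMono₂ (m ≫ f) (m ≫ g) where
  right_cancellation _ k l hf hg := (cancel_mono m).1 <|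
    JointlyMono₂.right_cancellation (p₁ := f) (p₂ := g) _ _ (by simpa using hf) (by simpa using hg)

instance jointlyMono₂_prod_fst_snd [HasBinaryProduct A B] :
    JointlyMono₂ (prod.fst : A ⨯ B ⟶ A) prod.snd where
  right_cancellation _ _ _ := Limits.prod.hom_ext

instance jointlyMono₂_pullback_fst_snd (f : A ⟶ P) (g : B ⟶ P) [HasPullback f g] :
    JointlyMono₂ (pullback.fst f g) (pullback.snd f g) where
  right_cancellation _ _ _ := pullback.hom_ext

instance mono_prod_lift (f : P ⟶ A) (g : P ⟶ B) [HasBinaryProduct A B] [JointlyMono₂ f g] :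
    Mono (prod.lift f g) where
  right_cancellation k l h :=
    JointlyMono₂.right_cancellation (p₁ := f) (p₂ := g) k l
      (by simpa [prod.lift_fst] using h =≫ prod.fst)
      (by simpa [prod.lift_snd] using h =≫ prod.snd)

end JointlyMono

/-- The generalized elements `a` and `b` of `A` and `B` are related by the span
`A ⟵ D ⟶ B` with legs `p` and `q` if they are the components of a generalized element of `D`. -/
def SpanRel {E : Type u} [Category.{v} E] {A B D T : E} (p : D ⟶ A) (q : D ⟶ B)
    (a : T ⟶ A) (b : T ⟶ B) : Prop :=
  ∃ d : T ⟶ D, d ≫ p = a ∧ d ≫ q = b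

/-- A span is difunctional if, on generalized elements, `a D b`, `a' D b` and `a' D b'` imply
`a D b'`. The span is not required to be jointly monic. -/
def IsDifunctional {E : Type u} [Category.{v} E] {A B D : E} (p : D ⟶ A) (q : D ⟶ B) : Prop :=
  ∀ ⦃T : E⦄ ⦃a a' : T ⟶ A⦄ ⦃b b' : T ⟶ B⦄,
    SpanRel p q a b → SpanRel p q a' b → SpanRel p q a' b' → SpanRel p q a b'

namespace SpanRel

variable {E : Type u} [Category.{v} E] {A B D P T : E}

lemma comp (p : D ⟶ A) (q : D ⟶ B) (d : T ⟶ D) : SpanRel p q (d ≫ p) (d ≫ q) :=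
  ⟨d, rfl, rfl⟩

lemma refl {d₀ d₁ : D ⟶ A} (e : ReflexiveRelation d₀ d₁) (a : T ⟶ A) : SpanRel d₀ d₁ a a :=
  ⟨a ≫ e.r, by simp, by simp⟩

lemma symm {d₀ d₁ : D ⟶ A} (e : SymmetricRelation d₀ d₁) {a b : T ⟶ A}
    (h : SpanRel d₀ d₁ a b) : SpanRel d₀ d₁ b a := by
  obtain ⟨d, rfl, rfl⟩ := h
  exact ⟨d ≫ e.s, by simp, by simp⟩

lemma arrow_comp_iff_factors (S : Subobject P) (f : P ⟶ A) (g : P ⟶ B) [JointlyMono₂ f g]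
    (t : T ⟶ P) : SpanRel (S.arrow ≫ f) (S.arrow ≫ g) (t ≫ f) (t ≫ g) ↔ S.Factors t := by
  constructor
  · rintro ⟨d, hf, hg⟩
    have hd : d ≫ S.arrow = t :=
      JointlyMono₂.right_cancellation (p₁ := f) (p₂ := g) _ _
        (by simpa using hf) (by simpa using hg)
    exact hd ▸ Subobject.factors_comp_arrow d
  · intro h
    exact ⟨S.factorThru t h, by simp, by simp⟩

/-- The largest subobject of `P` on which the maps `a` and `b` are related by the relation with
legs `p` and `q`. -/
noncomputable def locus [HasPullbacks E] [HasBinaryProduct A B] (p : D ⟶ A) (q : D ⟶ B)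
    [JointlyMono₂ p q] (a : P ⟶ A) (b : P ⟶ B) : Subobject P :=
  (Subobject.pullback (prod.lift a b)).obj (Subobject.mk (prod.lift p q))

lemma locus_factors_iff [HasPullbacks E] [HasBinaryProduct A B] (p : D ⟶ A) (q : D ⟶ B)
    [JointlyMono₂ p q] (a : P ⟶ A) (b : P ⟶ B) (t : T ⟶ P) :
    (locus p q a b).Factors t ↔ SpanRel p q (t ≫ a) (t ≫ b) := by
  rw [locus, pullback_factors_iff, prod.comp_lift]
  change (∃ d : T ⟶ D, d ≫ prod.lift p q = prod.lift (t ≫ a) (t ≫ b)) ↔ _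
  refine exists_congr fun d ↦ ?_
  rw [prod.comp_lift]
  exact ⟨fun h ↦ ⟨by simpa [prod.lift_fst] using h =≫ prod.fst,
    by simpa [prod.lift_snd] using h =≫ prod.snd⟩, fun ⟨ha, hb⟩ ↦ by rw [ha, hb]⟩

end SpanRel

section Difunctional

variable {E : Type u} [Category.{v} E]

theorem isDifunctional_of_isMaltsevCategory [IsMaltsevCategory E] {A B D : E} (p : D ⟶ A)
    (q : D ⟶ B) [JointlyMono₂ p q] : IsDifunctional p q := by
  rintro T _ _ _ _ ⟨d₁, rfl, rfl⟩ ⟨d₂, rfl, h₁₂⟩ ⟨d₃, h₂₃, rfl⟩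
  let S : Subobject (D ⨯ D) := SpanRel.locus p q (prod.fst ≫ p) (prod.snd ≫ q)
  have mem_S {T : E} (d d' : T ⟶ D) :
      S.Factors (prod.lift d d') ↔ SpanRel p q (d ≫ p) (d' ≫ q) := by
    rw [SpanRel.locus_factors_iff, prod.lift_fst_assoc, prod.lift_snd_assoc]
  have rel_S {T : E} (d d' : T ⟶ D) : SpanRel (S.arrow ≫ prod.fst) (S.arrow ≫ prod.snd) d d' ↔
      SpanRel p q (d ≫ p) (d' ≫ q) := by
    rw [← mem_S, ← SpanRel.arrow_comp_iff_factors S prod.fst prod.snd, prod.lift_fst, prod.lift_snd]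
  obtain ⟨r, hr₀, hr₁⟩ := (rel_S (𝟙 D) (𝟙 D)).2 (SpanRel.comp p q _)
  have reflexive : ReflexiveRelation (S.arrow ≫ prod.fst) (S.arrow ≫ prod.snd) :=
    { jointlyMono₂_comp S.arrow prod.fst prod.snd with
      r := r
      reflexivity₁ := hr₀
      reflexivity₂ := hr₁ }
  obtain ⟨⟨equivalence⟩⟩ := IsMaltsevCategory.isEquivalenceRelation_of_reflexive _ _ reflexive
  have h₃₁ : SpanRel p q (d₃ ≫ p) (d₁ ≫ q) := ⟨d₂, h₂₃.symm, h₁₂⟩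
  exact (rel_S d₁ d₃).1 (((rel_S d₃ d₁).2 h₃₁).symm equivalence.toSymmetricRelation)

theorem IsDifunctional.isEquivalenceRelation [HasPullbacks E] {R X : E} {d₀ d₁ : R ⟶ X}
    (h : IsDifunctional d₀ d₁) (e : ReflexiveRelation d₀ d₁) : IsEquivalenceRelation d₀ d₁ := by
  have symmetric : SpanRel d₀ d₁ d₁ d₀ :=
    h (SpanRel.refl e d₁) ⟨𝟙 R, by simp, by simp⟩ (SpanRel.refl e d₀)
  have transitive : SpanRel d₀ d₁ (pullback.fst d₁ d₀ ≫ d₀) (pullback.snd d₁ d₀ ≫ d₁) :=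
    h (SpanRel.comp d₀ d₁ _) (SpanRel.refl e _) (by
      rw [pullback.condition]; exact SpanRel.comp d₀ d₁ _)
  obtain ⟨s, hs₀, hs₁⟩ := symmetric
  obtain ⟨t, ht₀, ht₁⟩ := transitive
  exact ⟨⟨{
    e with
    s := s
    symmetry₁ := hs₀
    symmetry₂ := hs₁
    c := _
    isLimit := pullbackIsPullback d₁ d₀
    t := t
    transitivity₁ := ht₀
    transitivity₂ := ht₁ }⟩⟩

theorem isMaltsevCategory_iff_isDifunctional [HasFiniteLimits E] :
    IsMaltsevCategory E ↔
      ∀ {A B D : E} (p : D ⟶ A) (q : D ⟶ B) [JointlyMono₂ p q], IsDifunctional p q :=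
  ⟨fun _ _ _ _ p q _ ↦ isDifunctional_of_isMaltsevCategory p q, fun h ↦
    { isEquivalenceRelation_of_reflexive := fun d₀ d₁ e ↦
        have := e.toJointlyMono₂
        (h d₀ d₁).isEquivalenceRelation e }⟩

end Difunctional

section RegularPushout

variable {E : Type u} [Category.{v} E]

lemma Pt.factors_of_factors_comparison [HasPullbacks E] {A B : Pt E} {φ : A ⟶ B}
    {S : Subobject (pullback B.f φ.y)}
    (hS : IsDifunctional (S.arrow ≫ pullback.fst B.f φ.y) (S.arrow ≫ pullback.snd B.f φ.y))
    (h : S.Factors (Pt.comparison φ)) {T : E} (t : T ⟶ pullback B.f φ.y) (a : T ⟶ A.X)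
    (ha : a ≫ φ.x = t ≫ pullback.fst B.f φ.y) : S.Factors t := by
  have rel_comparison (z : T ⟶ A.X) : SpanRel (S.arrow ≫ pullback.fst B.f φ.y)
      (S.arrow ≫ pullback.snd B.f φ.y) (z ≫ φ.x) (z ≫ A.f) := by
    simpa [Pt.comparison, pullback.lift_fst, pullback.lift_snd] using
      (SpanRel.arrow_comp_iff_factors S (pullback.fst B.f φ.y) (pullback.snd B.f φ.y) _).2
        (Subobject.factors_of_factors_right z h)
  have base_eq : a ≫ A.f ≫ φ.y = t ≫ pullback.snd B.f φ.y ≫ φ.y := by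
    rw [← φ.comm_f, reassoc_of% ha, pullback.condition]
  rw [← SpanRel.arrow_comp_iff_factors S (pullback.fst B.f φ.y) (pullback.snd B.f φ.y), ← ha]
  refine hS (rel_comparison a) (a' := a ≫ A.f ≫ A.s ≫ φ.x) ?_ ?_
  · simpa [A.section_comp] using rel_comparison (a ≫ A.f ≫ A.s)
  · simpa [A.section_comp, φ.comm_s, reassoc_of% base_eq] using
      rel_comparison (t ≫ pullback.snd B.f φ.y ≫ A.s)

theorem Pt.isRegularPushout_of_isMaltsevCategory [Regular E] [IsMaltsevCategory E] {A B : Pt E}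
    (φ : A ⟶ B) [IsRegularEpi φ.x] : Pt.IsRegularPushout φ := by
  have : ExtremalEpi (Pt.comparison φ) := .mk_of_hasEqualizers _ fun Z e m fac _ ↦ by
    have := jointlyMono₂_comp (Subobject.mk m).arrow (pullback.fst B.f φ.y) (pullback.snd B.f φ.y)
    have factors_comparison : (Subobject.mk m).Factors (Pt.comparison φ) := ⟨e, fac⟩
    have factors_snd : (Subobject.mk m).Factors (pullback.snd φ.x (pullback.fst B.f φ.y)) :=
      Pt.factors_of_factors_comparison (isDifunctional_of_isMaltsevCategory _ _)
        factors_comparison _ (pullback.fst φ.x (pullback.fst B.f φ.y)) pullback.condition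
    exact (Subobject.isIso_iff_mk_eq_top m).2 (ExtremalEpi.subobject_eq_top _ factors_snd)
  exact Regular.isRegularEpi_of_extremalEpi (Pt.comparison φ)

end RegularPushout

/-- The fibres of the fibration of points are unital: for split epimorphisms `f : X ⟶ Y` and
`g : Z ⟶ Y`, the maps `X ⟶ X ×_Y Z` and `Z ⟶ X ×_Y Z` induced by the sections are jointly
extremally epic. -/
def PointFibresUnital (E : Type u) [Category.{v} E] [HasPullbacks E] : Prop :=
  ∀ ⦃X Y Z : E⦄ ⦃f : X ⟶ Y⦄ ⦃g : Z ⟶ Y⦄ (s : SplitEpi f) (t : SplitEpi g)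
    (S : Subobject (pullback f g)),
    S.Factors (pullback.lift (𝟙 X) (f ≫ t.section_) (by simp)) →
    S.Factors (pullback.lift (g ≫ s.section_) (𝟙 Z) (by simp)) → S = ⊤

namespace PointFibresUnital

variable {E : Type u} [Category.{v} E]

theorem of_isRegularPushout [HasPullbacks E]
    (H : ∀ (A B : Pt E) (φ : A ⟶ B), IsRegularEpi φ.x → IsRegularEpi φ.y →
      Pt.IsRegularPushout φ) : PointFibresUnital E := by
  rintro X Y Z f g s t S hX hZ
  let i : X ⟶ S := S.factorThru _ hX
  let j : Z ⟶ S := S.factorThru _ hZ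
  have hi : i ≫ S.arrow ≫ pullback.fst f g = 𝟙 X := by simp [i, pullback.lift_fst]
  have hj₁ : j ≫ S.arrow ≫ pullback.fst f g = g ≫ s.section_ := by simp [j, pullback.lift_fst]
  have hj₂ : j ≫ S.arrow ≫ pullback.snd f g = 𝟙 Z := by simp [j, pullback.lift_snd]
  let A : Pt E := ⟨S, Z, S.arrow ≫ pullback.snd f g, j, hj₂⟩
  let B : Pt E := ⟨X, Y, f, s.section_, s.id⟩
  let φ : A ⟶ B := Pt.Hom.mk (A := A) (B := B) (S.arrow ≫ pullback.fst f g) g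
    (by simp [A, B, pullback.condition]) hj₁
  have : IsSplitEpi φ.x := ⟨⟨i, hi⟩⟩
  have : IsSplitEpi φ.y := ⟨⟨t⟩⟩
  have comparison_eq : Pt.comparison φ = S.arrow := by
    apply pullback.hom_ext
    · exact pullback.lift_fst _ _ _
    · exact pullback.lift_snd _ _ _
  have : IsRegularEpi S.arrow := comparison_eq ▸ H A B φ inferInstance inferInstance
  rw [← Subobject.isIso_arrow_iff_eq_top]
  exact isIso_of_mono_of_strongEpi S.arrow

theorem isDifunctional [HasPullbacks E] (hE : PointFibresUnital E) {A B D : E}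
    [HasBinaryProduct A B] (p : D ⟶ A) (q : D ⟶ B) [JointlyMono₂ p q] : IsDifunctional p q := by
  rintro T _ _ _ _ ⟨d₁, rfl, rfl⟩ ⟨d₂, rfl, h₁₂⟩ ⟨d₃, h₂₃, rfl⟩
  let u := pullback.fst (pullback.snd q q) (pullback.fst p p)
  let w := pullback.snd (pullback.snd q q) (pullback.fst p p)
  let S := SpanRel.locus p q (u ≫ pullback.fst q q ≫ p) (w ≫ pullback.snd p p ≫ q)
  have S_eq_top : S = ⊤ := by
    refine hE ⟨pullback.diagonal q, pullback.diagonal_snd q⟩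
      ⟨pullback.diagonal p, pullback.diagonal_fst p⟩ S ?_ ?_
    · rw [SpanRel.locus_factors_iff]
      exact ⟨pullback.fst q q, by simp [u, pullback.lift_fst_assoc],
        by simp [w, pullback.lift_snd_assoc, pullback.condition]⟩
    · rw [SpanRel.locus_factors_iff]
      exact ⟨pullback.snd p p, by simp [u, pullback.lift_fst_assoc, pullback.condition],
        by simp [w, pullback.lift_snd_assoc]⟩
  let triple : T ⟶ pullback (pullback.snd q q) (pullback.fst p p) :=
    pullback.lift (pullback.lift d₁ d₂ h₁₂.symm) (pullback.lift d₂ d₃ h₂₃.symm)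
      (by simp [pullback.lift_fst, pullback.lift_snd])
  have mem_S : S.Factors triple := S_eq_top ▸ Subobject.top_factors triple
  simpa [triple, u, w, pullback.lift_fst_assoc, pullback.lift_snd_assoc] using
    (SpanRel.locus_factors_iff p q _ _ triple).1 mem_S

end PointFibresUnital

theorem mainTheorem8 (E : Type u) [Category.{v} E] [Regular E] :
    IsMaltsevCategory E ↔
      ∀ (A B : Pt E) (φ : A ⟶ B), IsRegularEpi φ.x → IsRegularEpi φ.y →
        Pt.IsRegularPushout φ := by
  refine ⟨fun _ A B φ _ _ ↦ Pt.isRegularPushout_of_isMaltsevCategory φ, fun H ↦ ?_⟩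
  have unital : PointFibresUnital E := .of_isRegularPushout H
  exact isMaltsevCategory_iff_isDifunctional.2 unital.isDifunctional
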